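/- **Theorem 8.1.** Let $(B_s)_{s\ge 0}$ be a standard Brownian motion with $B_0=0$, and for $n \ge 2$ put $$\hat L_n := \int_1^n \frac{B_s^2}{s^2}\,ds .$$ Then for every fixed real $t>-1/8$ there is a constant $C=C(t)$, depending only on $t$, such that for all real $n\ge 2$ (in particular for all integers $n \ge 2$) the expectation $\mathbb E\, e^{-t\hat L_n}$ is finite and $$\Bigl|\ln \mathbb E\, e^{-t\hat L_n} - \frac{1-\sqrt{1+8t}}{4}\,\ln n\Bigr| \le C .$$ -/

import Mathlib

open MeasureTheory ProbabilityTheory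
open scoped NNReal

/-- The random variable `∫ s in 1..n, B_s ^ 2 / s ^ 2` attached to a real process `B` indexed by
`[0, ∞)`. When the path of `ω` is continuous and `1 ≤ n`, this is the integral of a continuous
function over the compact interval `[1, n]`. -/
noncomputable def Lhat {Ω : Type*} (B : ℝ≥0 → Ω → ℝ) (n : ℝ) (ω : Ω) : ℝ :=
  ∫ s in (1 : ℝ)..n, (B s.toNNReal ω) ^ 2 / s ^ 2

/-! The substitution `s = exp u` turns `Lhat` into an integral over `[0, ln n]`, approximated by
Riemann sums over a geometric grid of times. Integrating out the Gaussian increments from the last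
one back (`lintegral_exp_add_sq`) keeps the exponent quadratic. Its coefficient `p` follows a
Riccati recursion, tuned to have fixed point `β > -1/2`, where `β * (1 + β) / 2 = t`. Each step
costs a factor `(1 + p * b) ^ (-1/2)`. Since `p` contracts to `β` (`exists_riccati_contraction`),
replacing it by `β` costs a bounded total, uniformly in the mesh, and `N` factors `(1 + β * b) ^
(-1/2)` tend to `n ^ (-β / 2)`. The bounds survive refinement of the mesh by uniform integrability
(`tendsto_lintegral_exp_of_moment_bound`): as `t > -1/8` is an open condition, a slightly higher
exponential moment is also controlled. -/

/-! ### Integrating out one Gaussian increment. -/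

/-- Completing the square: the integrand is a constant times the Gaussian density of mean `m` and
variance `v / (1 + q * v)`. -/
theorem lintegral_exp_neg_sq_gaussianReal {v : ℝ≥0} (hv : v ≠ 0) (q x : ℝ) (h : 0 < 1 + q * v) :
    ∫⁻ y, ENNReal.ofReal (Real.exp (-(q / 2) * (x + y) ^ 2)) ∂gaussianReal 0 v =
      ENNReal.ofReal (Real.exp
        (-(q / (2 * (1 + q * v))) * x ^ 2 - Real.log (1 + q * v) / 2)) := by
  set w : ℝ≥0 := ⟨v / (1 + q * v), by positivity⟩ with hw
  have hv' : (0 : ℝ) < v := by positivity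
  have hwv : (w : ℝ) = v / (1 + q * v) := rfl
  have hw0 : w ≠ 0 := by
    rw [← NNReal.coe_ne_zero, hwv]; positivity
  set m : ℝ := -(q * v * x / (1 + q * v)) with hm
  have key (y : ℝ) : gaussianPDF 0 v y * ENNReal.ofReal (Real.exp (-(q / 2) * (x + y) ^ 2)) =
      ENNReal.ofReal (Real.exp (-(q / (2 * (1 + q * v))) * x ^ 2 - Real.log (1 + q * v) / 2)) *
        gaussianPDF m w y := by
    rw [gaussianPDF, gaussianPDF, ← ENNReal.ofReal_mul (gaussianPDFReal_nonneg _ _ _),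
      ← ENNReal.ofReal_mul (Real.exp_pos _).le]
    congr 1
    rw [gaussianPDFReal, gaussianPDFReal, hwv, Real.exp_sub, ← Real.log_sqrt h.le,
      Real.exp_log (Real.sqrt_pos.2 h), ← mul_div_assoc, Real.sqrt_div (by positivity)]
    have e : -(y - 0) ^ 2 / (2 * (v : ℝ)) + -(q / 2) * (x + y) ^ 2 =
        -(q / (2 * (1 + q * v))) * x ^ 2 + -(y - m) ^ 2 / (2 * v / (1 + q * v)) := by
      have hd : 1 + q * (v : ℝ) ≠ 0 := h.ne'
      rw [hm]
      generalize hd' : 1 + q * (v : ℝ) = d at hd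
      field_simp
      subst hd'
      ring
    have s0 := (Real.sqrt_pos.2 h).ne'
    rw [mul_assoc, ← Real.exp_add, e, Real.exp_add, ← mul_div_assoc]
    generalize √(1 + q * (v : ℝ)) = d at s0
    field_simp
  rw [gaussianReal_of_var_ne_zero 0 hv, lintegral_withDensity_eq_lintegral_mul _
    (measurable_gaussianPDF 0 v) (by fun_prop)]
  simp only [Pi.mul_apply, key]
  rw [lintegral_const_mul _ (measurable_gaussianPDF m w), lintegral_gaussianPDF_eq_one m hw0,
    mul_one]

namespace ProbabilityTheory.IsPreBrownianReal

variable {Ω : Type*} [MeasurableSpace Ω] {P : Measure Ω} {B : ℝ≥0 → Ω → ℝ}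

/-- Integrating out the last increment of a Gaussian functional of a Brownian motion. -/
theorem lintegral_exp_add_sq (hB : IsPreBrownianReal B P) {s u : ℝ≥0} (hsu : s < u)
    {F : (Set.Iic s → ℝ) → ℝ}
    (hF : Measurable F)
    (hFB : AEMeasurable (fun ω ↦ F (fun i ↦ B i ω)) P) {q : ℝ} (hq : 0 < 1 + q * (u - s)) :
    ∫⁻ ω, ENNReal.ofReal (Real.exp (F (fun i ↦ B i ω) - q / 2 * B u ω ^ 2)) ∂P =
      ∫⁻ ω, ENNReal.ofReal (Real.exp (F (fun i ↦ B i ω) - q / (2 * (1 + q * (u - s))) * B s ω ^ 2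
        - Real.log (1 + q * (u - s)) / 2)) ∂P := by
  have : IsProbabilityMeasure P := hB.isGaussianProcess.isProbabilityMeasure
  have hus : ((u - s : ℝ≥0) : ℝ) = u - s := NNReal.coe_sub hsu.le
  let s' : Set.Iic s := ⟨s, Set.self_mem_Iic⟩
  have hφ : Measurable (fun f : ℝ≥0 → ℝ ↦ f (u - s)) := measurable_pi_apply _
  -- The past enters only through the pair `(F, B s)`, so the computation takes place under a
  -- product law.
  have hψ : Measurable (fun g : Set.Iic s → ℝ ↦ (F g, g s')) :=
    hF.prodMk (measurable_pi_apply _)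
  have hind := (hB.indepFun_shift s).comp hφ hψ
  have hlaw := (hB.shift s).hasLaw_eval (u - s)
  have hW : AEMeasurable ((fun g : Set.Iic s → ℝ ↦ (F g, g s')) ∘ fun ω (i : Set.Iic s) ↦ B i ω) P :=
    hFB.prodMk (hB.aemeasurable s)
  have hmap := (indepFun_iff_map_prod_eq_prod_map_map hW hlaw.aemeasurable).1 hind.symm
  set ν := P.map ((fun g : Set.Iic s → ℝ ↦ (F g, g s')) ∘ fun ω (i : Set.Iic s) ↦ B i ω) with hν
  have : IsProbabilityMeasure ν := Measure.isProbabilityMeasure_map hW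
  rw [hlaw.map_eq] at hmap
  have hv : u - s ≠ 0 := (tsub_pos_of_lt hsu).ne'
  calc _ = ∫⁻ z, ENNReal.ofReal (Real.exp (z.1.1 + -(q / 2) * (z.1.2 + z.2) ^ 2))
        ∂(ν.prod (gaussianReal 0 (u - s))) := by
        rw [← hmap, lintegral_map' (by fun_prop) (hW.prodMk hlaw.aemeasurable)]
        refine lintegral_congr fun ω ↦ ?_
        simp only [Function.comp_apply, s', add_tsub_cancel_of_le hsu.le]
        ring_nf
    _ = ∫⁻ w, ENNReal.ofReal (Real.exp (w.1 - q / (2 * (1 + q * (u - s))) * w.2 ^ 2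
        - Real.log (1 + q * (u - s)) / 2)) ∂ν := by
        rw [lintegral_prod _ (by fun_prop)]
        refine lintegral_congr fun w ↦ ?_
        simp only [Real.exp_add, ENNReal.ofReal_mul (Real.exp_pos _).le]
        rw [lintegral_const_mul _ (by fun_prop), lintegral_exp_neg_sq_gaussianReal hv q w.2
          (by rwa [hus]), ← ENNReal.ofReal_mul (Real.exp_pos _).le, ← Real.exp_add, hus]
        ring_nf
    _ = _ := by
        rw [hν, lintegral_map' (by fun_prop) hW]
        rfl

end ProbabilityTheory.IsPreBrownianReal

/-! ### The Riccati recursion along a geometric grid. -/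

theorem abs_log_sub_log_le {x y : ℝ} (hx : 1 / 2 ≤ x) (hy : 1 / 2 ≤ y) :
    |Real.log x - Real.log y| ≤ 2 * |x - y| := by
  wlog h : y ≤ x generalizing x y
  · rw [abs_sub_comm, abs_sub_comm x]
    exact this hy hx (le_of_not_ge h)
  have hy0 : 0 < y := by linarith
  have hx0 : 0 < x := by linarith
  rw [abs_of_nonneg (sub_nonneg.2 (Real.log_le_log hy0 h)), abs_of_nonneg (sub_nonneg.2 h),
    ← Real.log_div hx0.ne' hy0.ne']
  refine (Real.log_le_sub_one_of_pos (by positivity)).trans ?_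
  rw [div_sub_one hy0.ne', div_le_iff₀ hy0]
  nlinarith

/-- One step of the Riccati recursion contracts towards its fixed point `β`. -/
theorem exists_riccati_contraction {β b p : ℝ} (hβ : -(1 / 2) < β) (hb0 : 0 ≤ b) (hb1 : b ≤ 1)
    (hp : p ∈ Set.uIcc 0 β) :
    ∃ κ, 0 ≤ κ ∧ κ ≤ 1 - (1 + 2 * min 0 β) * b ∧
      β * (1 + β) * b / (1 + β * b) + p * (1 - b) / (1 + p * b) = β + κ * (p - β) := by
  have hmp : min 0 β ≤ p := hp.1
  have hmβ : min 0 β ≤ β := min_le_right _ _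
  have hm0 : min 0 β ≤ 0 := min_le_left _ _
  have hm : -(1 / 2) < min 0 β := lt_min (by norm_num) hβ
  generalize min 0 β = m at *
  have h1 : 0 < 1 + m * b := by nlinarith
  have h2 : 1 + m * b ≤ 1 + β * b := by nlinarith
  have h3 : 1 + m * b ≤ 1 + p * b := by nlinarith
  have h4 : 0 < 1 + β * b := h1.trans_le h2
  have h5 : 0 < 1 + p * b := h1.trans_le h3
  -- The difference quotient of `p ↦ p * (1 - b) / (1 + p * b)` between `p` and `β`.
  refine ⟨(1 - b) / ((1 + β * b) * (1 + p * b)), ?_, ?_, ?_⟩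
  · exact div_nonneg (by linarith) (by positivity)
  · rw [div_le_iff₀ (by positivity)]
    have h6 : (1 + m * b) * (1 + m * b) ≤ (1 + β * b) * (1 + p * b) :=
      mul_le_mul h2 h3 h1.le h4.le
    have h7 : 0 ≤ 1 - (1 + 2 * m) * b := by nlinarith
    -- The worst case, with `p` and `β` both replaced by `m`.
    have h8 : (1 - b) ≤ (1 - (1 + 2 * m) * b) * ((1 + m * b) * (1 + m * b)) := by
      have : (1 - (1 + 2 * m) * b) * ((1 + m * b) * (1 + m * b)) - (1 - b) =
        b ^ 2 * (-m) * (2 * (1 + 2 * m) - m + m * (1 + 2 * m) * b) := by ring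
      have h9 : 0 ≤ 2 * (1 + 2 * m) - m + m * (1 + 2 * m) * b := by
        have : 0 ≤ (1 + 2 * m) * (2 + m * b) := by
          apply mul_nonneg <;> linarith
        nlinarith
      have : 0 ≤ b ^ 2 * (-m) * (2 * (1 + 2 * m) - m + m * (1 + 2 * m) * b) :=
        mul_nonneg (mul_nonneg (sq_nonneg _) (by linarith)) h9
      linarith
    exact h8.trans (mul_le_mul_of_nonneg_left h6 h7)
  · generalize hd : 1 + β * b = d at h4
    generalize he : 1 + p * b = e at h5
    field_simp
    subst hd he
    ring

namespace ProbabilityTheory.IsPreBrownianReal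

variable {Ω : Type*} [MeasurableSpace Ω] {P : Measure Ω} {B : ℝ≥0 → Ω → ℝ}

/-- The terminal coefficient `p` is left free so that induction on `N` can absorb the last grid
point into a new `p`. -/
theorem exists_lintegral_exp_sum_geometric (hB : IsPreBrownianReal B P) {β : ℝ}
    (hβ : -(1 / 2) < β) {r : ℝ≥0} (hr : 1 < r) {b : ℝ} (hb : b = 1 - 1 / r) (N : ℕ) {p : ℝ}
    (hp : p ∈ Set.uIcc 0 β) :
    ∃ x, |x + N / 2 * Real.log (1 + β * b)| ≤ |p - β| / (1 + 2 * min 0 β) + |β| ∧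
      ∫⁻ ω, ENNReal.ofReal (Real.exp
        (-(β * (1 + β) * b / (1 + β * b) / 2) *
            ∑ k ∈ Finset.range N, B (r ^ k) ω ^ 2 / r ^ k -
          p / 2 * (B (r ^ N) ω ^ 2 / r ^ N))) ∂P = ENNReal.ofReal (Real.exp x) := by
  have hr' : (1 : ℝ) < r := by exact_mod_cast hr
  have hb0 : 0 < b := by
    rw [hb, sub_pos, div_lt_one (by linarith)]; exact hr'
  have hb1 : b ≤ 1 := by
    rw [hb]; simp
  have hm : -(1 / 2) < min 0 β := lt_min (by norm_num) hβ
  have hc : 0 < 1 + 2 * min 0 β := by linarith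
  have hmβ : min 0 β ≤ β := min_le_right _ _
  have hm0 : min 0 β ≤ 0 := min_le_left _ _
  induction N generalizing p with
  | zero =>
    have hmp : min 0 β ≤ p := hp.1
    refine ⟨-(Real.log (1 + p) / 2), ?_, ?_⟩
    · have h1 : |Real.log (1 + p) - Real.log 1| ≤ 2 * |1 + p - 1| :=
        abs_log_sub_log_le (by linarith) (by norm_num)
      have h2 : |p| ≤ |β| := by simpa using Set.abs_sub_left_of_mem_uIcc hp
      have h3 : 0 ≤ |p - β| / (1 + 2 * min 0 β) := by positivity
      simp only [Real.log_one, sub_zero, add_sub_cancel_left] at h1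
      simp only [Nat.cast_zero, zero_div, zero_mul, add_zero, abs_neg, abs_div, Nat.abs_ofNat]
      linarith
    · have h := (hB.hasLaw_eval 1).lintegral_comp
        (f := fun y ↦ ENNReal.ofReal (Real.exp (-(p / 2) * (0 + y) ^ 2))) (by fun_prop)
      rw [lintegral_exp_neg_sq_gaussianReal one_ne_zero p 0
        (by simp only [NNReal.coe_one]; linarith)] at h
      simpa using h
  | succ N ih =>
    have hmp : min 0 β ≤ p := hp.1
    obtain ⟨κ, hκ0, hκ1, hκ⟩ := exists_riccati_contraction hβ hb0.le hb1 hp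
    have hκ2 : κ ≤ 1 := by nlinarith
    have hp' : β + κ * (p - β) ∈ Set.uIcc 0 β := by
      have := (convex_uIcc 0 β) hp Set.right_mem_uIcc hκ0 (sub_nonneg.2 hκ2) (by ring)
      convert this using 1
      simp only [smul_eq_mul]; ring
    obtain ⟨x, hx, hxe⟩ := ih hp'
    have hpb : 1 / 2 ≤ 1 + p * b := by nlinarith
    have hβb : 1 / 2 ≤ 1 + β * b := by nlinarith
    refine ⟨x - Real.log (1 + p * b) / 2, ?_, ?_⟩
    · have h1 := abs_log_sub_log_le hpb hβb
      rw [show 1 + p * b - (1 + β * b) = b * (p - β) by ring, abs_mul, abs_of_pos hb0] at h1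
      rw [show β + κ * (p - β) - β = κ * (p - β) by ring, abs_mul, abs_of_nonneg hκ0] at hx
      -- The geometric series of errors in closed form: `κ ≤ 1 - (1 + 2 * min 0 β) * b` leaves room
      -- for exactly this step's `b * |p - β|`.
      have h2 : κ * |p - β| / (1 + 2 * min 0 β) + b * |p - β| ≤
          |p - β| / (1 + 2 * min 0 β) := by
        rw [div_add' _ _ _ hc.ne', div_le_div_iff_of_pos_right hc]
        nlinarith [abs_nonneg (p - β)]
      rw [show x - Real.log (1 + p * b) / 2 + ((N + 1 : ℕ) : ℝ) / 2 * Real.log (1 + β * b) =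
        (x + N / 2 * Real.log (1 + β * b)) -
          (Real.log (1 + p * b) - Real.log (1 + β * b)) / 2 by push_cast; ring]
      refine (abs_sub _ _).trans ?_
      rw [abs_div, Nat.abs_ofNat]
      linarith
    · have hlt : r ^ N < r ^ (N + 1) := pow_lt_pow_right₀ hr (Nat.lt_succ_self N)
      set τ := β * (1 + β) * b / (1 + β * b) with hτ
      have hrN : (0 : ℝ) < (r : ℝ) ^ N := by positivity
      have hq : p / (r : ℝ) ^ (N + 1) * (((r ^ (N + 1) : ℝ≥0) : ℝ) - ((r ^ N : ℝ≥0) : ℝ)) =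
          p * b := by
        push_cast
        rw [hb, pow_succ]
        field_simp
      -- Capping times at `r ^ N` makes every summand a function of the path up to `r ^ N`, and
      -- changes nothing on this range.
      have hmin (ω : Ω) : ∑ k ∈ Finset.range (N + 1), B (min (r ^ k) (r ^ N)) ω ^ 2 / (r : ℝ) ^ k =
          ∑ k ∈ Finset.range (N + 1), B (r ^ k) ω ^ 2 / (r : ℝ) ^ k := by
        refine Finset.sum_congr rfl fun k hk ↦ ?_
        rw [min_eq_left (pow_le_pow_right₀ hr.le (Nat.lt_succ_iff.1 (Finset.mem_range.1 hk)))]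
      have hFB : AEMeasurable (fun ω ↦ -(τ / 2) * ∑ k ∈ Finset.range (N + 1),
          B (min (r ^ k) (r ^ N)) ω ^ 2 / (r : ℝ) ^ k) P := by
        refine AEMeasurable.const_mul ?_ _
        refine Finset.aemeasurable_fun_sum _ fun k _ ↦ ?_
        exact ((hB.aemeasurable _).pow_const 2).div_const _
      have key := hB.lintegral_exp_add_sq hlt
        (F := fun g ↦ -(τ / 2) * ∑ k ∈ Finset.range (N + 1),
          g ⟨min (r ^ k) (r ^ N), Set.mem_Iic.2 (min_le_right _ _)⟩ ^ 2 / (r : ℝ) ^ k) (by fun_prop) hFB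
        (q := p / r ^ (N + 1)) (by rw [hq]; linarith)
      rw [hq] at key
      simp only [hmin] at key
      have hstart (ω : Ω) : -(τ / 2) * ∑ k ∈ Finset.range (N + 1), B (r ^ k) ω ^ 2 / (r : ℝ) ^ k -
          p / 2 * (B (r ^ (N + 1)) ω ^ 2 / (r : ℝ) ^ (N + 1)) =
          -(τ / 2) * ∑ k ∈ Finset.range (N + 1), B (r ^ k) ω ^ 2 / (r : ℝ) ^ k -
            p / (r : ℝ) ^ (N + 1) / 2 * B (r ^ (N + 1)) ω ^ 2 := by ring
      simp only [hstart]
      rw [key]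
      calc _ = ∫⁻ ω, ENNReal.ofReal (Real.exp (-(Real.log (1 + p * b) / 2))) *
              ENNReal.ofReal (Real.exp (-(τ / 2) *
                ∑ k ∈ Finset.range N, B (r ^ k) ω ^ 2 / r ^ k -
                (β + κ * (p - β)) / 2 * (B (r ^ N) ω ^ 2 / r ^ N))) ∂P := by
            refine lintegral_congr fun ω ↦ ?_
            rw [← ENNReal.ofReal_mul (Real.exp_pos _).le, ← Real.exp_add, ← hκ,
              Finset.sum_range_succ]
            congr 2
            have h0 : 1 + p * b ≠ 0 := by linarith
            have h1 : p / (r : ℝ) ^ (N + 1) / (2 * (1 + p * b)) =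
                p * (1 - b) / (1 + p * b) / 2 / r ^ N := by
              rw [show 1 - b = 1 / r by rw [hb]; ring, pow_succ]
              generalize 1 + p * b = d at h0
              field_simp
            rw [h1]
            ring
        _ = _ := by
            rw [lintegral_const_mul', hxe, ← ENNReal.ofReal_mul (Real.exp_pos _).le,
              ← Real.exp_add]
            · ring_nf
            · exact ENNReal.ofReal_ne_top

end ProbabilityTheory.IsPreBrownianReal

/-! ### Riemann sums, and limits as the mesh is refined. -/

open Filter Topology ENNReal

theorem Continuous.tendsto_riemann_sum {h : ℝ → ℝ} (hh : Continuous h) {T : ℝ} (hT : 0 ≤ T) :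
    Tendsto (fun N : ℕ ↦ T / N * ∑ k ∈ Finset.range N, h (k * (T / N))) atTop
      (𝓝 (∫ u in (0 : ℝ)..T, h u)) := by
  rw [Metric.tendsto_atTop]
  intro ε hε
  have huc : UniformContinuousOn h (Set.Icc 0 T) :=
    isCompact_Icc.uniformContinuousOn_of_continuous hh.continuousOn
  rw [Metric.uniformContinuousOn_iff] at huc
  obtain ⟨δ, hδ, hδh⟩ := huc (ε / (T + 1)) (by positivity)
  obtain ⟨N₀, hN₀⟩ := exists_nat_gt (T / δ)
  refine ⟨N₀ + 1, fun N hN ↦ ?_⟩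
  have hN0 : (0 : ℝ) < N := by exact_mod_cast (Nat.succ_pos _).trans_le hN
  have hNN : (N₀ : ℝ) < N := by exact_mod_cast hN
  set m := T / N with hm
  have hm0 : 0 ≤ m := by positivity
  have hmδ : m < δ := by
    rw [hm, div_lt_iff₀ hN0]
    rw [div_lt_iff₀ hδ] at hN₀
    nlinarith
  have hNm : N * m = T := by rw [hm]; field_simp
  have hsplit : ∫ u in (0 : ℝ)..T, h u =
      ∑ k ∈ Finset.range N, ∫ u in (k * m)..((k + 1 : ℕ) * m), h u := by
    rw [intervalIntegral.sum_integral_adjacent_intervals (a := fun k : ℕ ↦ (k : ℝ) * m)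
      (fun k _ ↦ hh.intervalIntegrable _ _)]
    simp [hNm]
  rw [dist_comm, Real.dist_eq, hsplit, Finset.mul_sum, ← Finset.sum_sub_distrib]
  refine (Finset.abs_sum_le_sum_abs _ _).trans_lt ?_
  have hpiece : ∀ k ∈ Finset.range N,
      |(∫ u in (k * m)..((k + 1 : ℕ) * m), h u) - m * h (k * m)| ≤ ε / (T + 1) * m := by
    intro k hk
    have hkN : ((k + 1 : ℕ) : ℝ) ≤ N := by exact_mod_cast Finset.mem_range.1 hk
    have hlen : ((k + 1 : ℕ) : ℝ) * m - k * m = m := by push_cast; ring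
    have hc : m * h (k * m) = ∫ _ in (k * m)..((k + 1 : ℕ) * m), h (k * m) := by
      rw [intervalIntegral.integral_const, hlen, smul_eq_mul]
    rw [hc, ← intervalIntegral.integral_sub (hh.intervalIntegrable _ _) (by simp)]
    have := intervalIntegral.norm_integral_le_of_norm_le_const (a := k * m)
      (b := (k + 1 : ℕ) * m) (f := fun u ↦ h u - h (k * m)) (C := ε / (T + 1)) ?_
    · rwa [hlen, abs_of_nonneg hm0] at this
    · intro u hu
      rw [Set.uIoc_of_le (by linarith)] at hu
      have hk0 : 0 ≤ (k : ℝ) * m := by positivity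
      have hup : ((k + 1 : ℕ) : ℝ) * m ≤ T := by
        rw [← hNm]; exact mul_le_mul_of_nonneg_right hkN hm0
      refine (hδh u ⟨by linarith [hu.1], hu.2.trans hup⟩ (k * m) ⟨hk0, by linarith⟩ ?_).le
      rw [Real.dist_eq, abs_of_nonneg (by linarith [hu.1])]
      linarith [hu.2]
  refine (Finset.sum_le_sum hpiece).trans_lt ?_
  rw [Finset.sum_const, Finset.card_range, nsmul_eq_mul]
  calc (N : ℝ) * (ε / (T + 1) * m) = ε / (T + 1) * (N * m) := by ring
    _ = ε * (T / (T + 1)) := by rw [hNm]; ring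
    _ < ε * 1 := by
        refine mul_lt_mul_of_pos_left ?_ hε
        rw [div_lt_one (by linarith)]; linarith
    _ = ε := mul_one ε

theorem integral_sq_div_sq_eq_integral_exp {g : ℝ → ℝ} (hg : Continuous g) {n : ℝ} (hn : 0 < n) :
    ∫ s in (1 : ℝ)..n, g s ^ 2 / s ^ 2 =
      ∫ u in (0 : ℝ)..Real.log n, g (Real.exp u) ^ 2 / Real.exp u := by
  have h := intervalIntegral.integral_comp_mul_deriv' (a := 0) (b := Real.log n) (f := Real.exp)
    (f' := Real.exp) (g := fun s ↦ g s ^ 2 / s ^ 2) (fun x _ ↦ Real.hasDerivAt_exp x)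
    Real.continuous_exp.continuousOn ?_
  · rw [Real.exp_zero, Real.exp_log hn] at h
    rw [← h]
    refine intervalIntegral.integral_congr fun u _ ↦ ?_
    have := Real.exp_pos u
    simp only [Function.comp_apply]
    field_simp
  · refine ContinuousOn.div (by fun_prop) (by fun_prop) ?_
    rintro _ ⟨u, -, rfl⟩
    positivity

/-- The lower bound is Fatou. For the upper bound, truncate at level `m`, where dominated
convergence applies; the excess is at most `exp (-ε * m)` times the higher moment, and `m → ∞`. -/
theorem tendsto_lintegral_exp_of_moment_bound {Ω : Type*} [MeasurableSpace Ω] {P : Measure Ω}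
    [IsFiniteMeasure P] {Y : ℕ → Ω → ℝ} {Z : Ω → ℝ} (hY : ∀ N, AEMeasurable (Y N) P)
    (hYZ : ∀ᵐ ω ∂P, Tendsto (fun N ↦ Y N ω) atTop (𝓝 (Z ω))) {ε : ℝ} (hε : 0 < ε) {K : ℝ}
    (hK : ∀ᶠ N in atTop, ∫⁻ ω, ENNReal.ofReal (Real.exp ((1 + ε) * Y N ω)) ∂P ≤
      ENNReal.ofReal K) :
    Tendsto (fun N ↦ ∫⁻ ω, ENNReal.ofReal (Real.exp (Y N ω)) ∂P) atTop
      (𝓝 (∫⁻ ω, ENNReal.ofReal (Real.exp (Z ω)) ∂P)) := by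
  refine tendsto_of_le_liminf_of_limsup_le ?_ ?_
  · calc _ = ∫⁻ ω, liminf (fun N ↦ ENNReal.ofReal (Real.exp (Y N ω))) atTop ∂P := by
          refine lintegral_congr_ae ?_
          filter_upwards [hYZ] with ω hω
          exact (ENNReal.tendsto_ofReal
            ((Real.continuous_exp.tendsto _).comp hω)).liminf_eq.symm
      _ ≤ _ := lintegral_liminf_le' fun N ↦ (by fun_prop)
  · have hpt (y m : ℝ) : ENNReal.ofReal (Real.exp y) ≤ ENNReal.ofReal (Real.exp (min y m)) +
        ENNReal.ofReal (Real.exp (-(ε * m))) * ENNReal.ofReal (Real.exp ((1 + ε) * y)) := by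
      rw [← ENNReal.ofReal_mul (Real.exp_pos _).le, ← Real.exp_add]
      rcases le_total y m with h | h
      · rw [min_eq_left h]; exact le_self_add
      · refine le_add_left (ENNReal.ofReal_le_ofReal (Real.exp_le_exp.2 ?_))
        nlinarith
    have hm (m : ℝ) : limsup (fun N ↦ ∫⁻ ω, ENNReal.ofReal (Real.exp (Y N ω)) ∂P) atTop ≤
        ∫⁻ ω, ENNReal.ofReal (Real.exp (Z ω)) ∂P +
          ENNReal.ofReal (Real.exp (-(ε * m))) * ENNReal.ofReal K := by
      have hlim : Tendsto (fun N ↦ ∫⁻ ω, ENNReal.ofReal (Real.exp (min (Y N ω) m)) ∂P) atTop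
          (𝓝 (∫⁻ ω, ENNReal.ofReal (Real.exp (min (Z ω) m)) ∂P)) := by
        refine tendsto_lintegral_of_dominated_convergence' (fun _ ↦ ENNReal.ofReal (Real.exp m))
          (fun N ↦ ?_) (fun N ↦ ae_of_all _ fun ω ↦ ?_) ?_ ?_
        · have := hY N; fun_prop
        · exact ENNReal.ofReal_le_ofReal (Real.exp_le_exp.2 (min_le_right _ _))
        · simp [ENNReal.mul_eq_top]
        · filter_upwards [hYZ] with ω hω
          exact ENNReal.tendsto_ofReal
            ((Real.continuous_exp.tendsto _).comp (hω.min tendsto_const_nhds))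
      calc _ ≤ limsup (fun N ↦ ∫⁻ ω, ENNReal.ofReal (Real.exp (min (Y N ω) m)) ∂P +
            ENNReal.ofReal (Real.exp (-(ε * m))) * ENNReal.ofReal K) atTop := by
            refine limsup_le_limsup ?_
            filter_upwards [hK] with N hN
            calc _ ≤ ∫⁻ ω, (ENNReal.ofReal (Real.exp (min (Y N ω) m)) +
                  ENNReal.ofReal (Real.exp (-(ε * m))) *
                    ENNReal.ofReal (Real.exp ((1 + ε) * Y N ω))) ∂P :=
                  lintegral_mono fun ω ↦ hpt _ _
              _ ≤ _ := by
                  have := hY N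
                  rw [lintegral_add_left' (by fun_prop), lintegral_const_mul' _ _ ofReal_ne_top]
                  gcongr
        _ = ∫⁻ ω, ENNReal.ofReal (Real.exp (min (Z ω) m)) ∂P +
            ENNReal.ofReal (Real.exp (-(ε * m))) * ENNReal.ofReal K :=
            (hlim.add_const _).limsup_eq
        _ ≤ _ := by
            gcongr
            exact min_le_left _ _
    refine ge_of_tendsto' (f := fun m : ℝ ↦ ∫⁻ ω, ENNReal.ofReal (Real.exp (Z ω)) ∂P +
          ENNReal.ofReal (Real.exp (-(ε * m))) * ENNReal.ofReal K) (x := atTop) ?_ hm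
    have h0 : Tendsto (fun m : ℝ ↦ ENNReal.ofReal (Real.exp (-(ε * m)))) atTop (𝓝 0) := by
      rw [← ENNReal.ofReal_zero]
      refine ENNReal.tendsto_ofReal (Real.tendsto_exp_neg_atTop_nhds_zero.comp ?_)
      exact tendsto_id.const_mul_atTop hε
    have h1 := ENNReal.Tendsto.mul_const (b := ENNReal.ofReal K) h0 (Or.inr ofReal_ne_top)
    simpa using h1.const_add (∫⁻ ω, ENNReal.ofReal (Real.exp (Z ω)) ∂P)

theorem tendsto_mul_one_sub_exp_neg_div {T : ℝ} (hT : 0 ≤ T) :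
    Tendsto (fun N : ℕ ↦ N * (1 - Real.exp (-(T / N)))) atTop (𝓝 T) := by
  have h0 : Tendsto (fun N : ℕ ↦ T / (N : ℝ)) atTop (𝓝 0) :=
    tendsto_const_div_atTop_nhds_zero_nat T
  have h1 : Tendsto (fun N : ℕ ↦ T / (1 + T / (N : ℝ))) atTop (𝓝 T) := by
    simpa [Pi.div_def] using (tendsto_const_nhds (x := T)).div (h0.const_add 1)
      (by norm_num : (1 + 0 : ℝ) ≠ 0)
  refine tendsto_of_tendsto_of_tendsto_of_le_of_le' h1 tendsto_const_nhds ?_ ?_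
  · filter_upwards [eventually_gt_atTop 0] with N hN
    have hN0 : (0 : ℝ) < N := by exact_mod_cast hN
    have hx : 0 ≤ T / N := by positivity
    have h2 : Real.exp (-(T / N)) ≤ 1 / (1 + T / N) := by
      rw [Real.exp_neg, ← one_div]
      exact one_div_le_one_div_of_le (by linarith) (by linarith [Real.add_one_le_exp (T / N)])
    calc T / (1 + T / N) = N * (1 - 1 / (1 + T / N)) := by field_simp; ring
      _ ≤ _ := by gcongr
  · filter_upwards [eventually_gt_atTop 0] with N hN
    have hN0 : (0 : ℝ) < N := by exact_mod_cast hN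
    calc (N : ℝ) * (1 - Real.exp (-(T / N))) ≤ N * (T / N) := by
          gcongr; linarith [Real.add_one_le_exp (-(T / N))]
      _ = T := by field_simp

theorem tendsto_one_sub_exp_neg_div (T : ℝ) :
    Tendsto (fun N : ℕ ↦ 1 - Real.exp (-(T / N))) atTop (𝓝 0) := by
  have h0 := (tendsto_const_div_atTop_nhds_zero_nat T).neg
  rw [neg_zero] at h0
  simpa using ((Real.continuous_exp.tendsto 0).comp h0).const_sub 1

/-- Squeeze using `1 - 1 / x ≤ log x ≤ x - 1`. -/
theorem tendsto_mul_log_one_add {b : ℕ → ℝ} {T : ℝ} (hb : Tendsto b atTop (𝓝 0))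
    (hbT : Tendsto (fun N : ℕ ↦ N * b N) atTop (𝓝 T)) (β : ℝ) :
    Tendsto (fun N : ℕ ↦ N * Real.log (1 + β * b N)) atTop (𝓝 (β * T)) := by
  have h1 : Tendsto (fun N ↦ 1 + β * b N) atTop (𝓝 1) := by
    simpa using (hb.const_mul β).const_add 1
  have h2 : Tendsto (fun N : ℕ ↦ β * (N * b N) / (1 + β * b N)) atTop (𝓝 (β * T)) := by
    simpa [Pi.div_def] using (hbT.const_mul β).div h1 one_ne_zero
  have hpos : ∀ᶠ N in atTop, 0 < 1 + β * b N := h1.eventually_const_lt one_pos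
  refine tendsto_of_tendsto_of_tendsto_of_le_of_le' h2 (hbT.const_mul β) ?_ ?_
  · filter_upwards [hpos] with N hN
    have := Real.one_sub_inv_le_log_of_pos hN
    calc β * (N * b N) / (1 + β * b N) = N * (1 - (1 + β * b N)⁻¹) := by
          field_simp; ring
      _ ≤ _ := by gcongr
  · filter_upwards [hpos] with N hN
    have := Real.log_le_sub_one_of_pos hN
    calc N * Real.log (1 + β * b N) ≤ N * (β * b N) := by gcongr; linarith
      _ = β * (N * b N) := by ring

/-! ### From the grid to the Laplace transform of `Lhat`. -/

namespace ProbabilityTheory.IsPreBrownianReal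

variable {Ω : Type*} [MeasurableSpace Ω] {P : Measure Ω} {B : ℝ≥0 → Ω → ℝ}

/-- The Laplace transform of the discretization of `Lhat B (exp T)` along a geometric grid. -/
theorem exists_lintegral_exp_grid (hB : IsPreBrownianReal B P) {β : ℝ} (hβ : -(1 / 2) < β)
    {T : ℝ} (hT : 0 < T) {N : ℕ} (hN : 0 < N) :
    ∃ x, |x + N / 2 * Real.log (1 + β * (1 - Real.exp (-(T / N))))| ≤
        |β| / (1 + 2 * min 0 β) + |β| ∧
      ∫⁻ ω, ENNReal.ofReal (Real.exp
        (-(β * (1 + β) * (1 - Real.exp (-(T / N))) / (1 + β * (1 - Real.exp (-(T / N)))) / 2) *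
          ∑ k ∈ Finset.range N, B (Real.exp (k * (T / N))).toNNReal ω ^ 2 /
            Real.exp (k * (T / N)))) ∂P = ENNReal.ofReal (Real.exp x) := by
  have hN0 : (0 : ℝ) < N := by exact_mod_cast hN
  have hr : 1 < (Real.exp (T / N)).toNNReal := by
    rw [Real.one_lt_toNNReal]
    exact Real.one_lt_exp_iff.2 (by positivity)
  have hb : 1 - Real.exp (-(T / N)) = 1 - 1 / ((Real.exp (T / N)).toNNReal : ℝ) := by
    rw [Real.coe_toNNReal _ (Real.exp_pos _).le, Real.exp_neg, one_div]
  -- With `p = 0` there is no terminal term, and the sum stops at `k = N - 1`.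
  obtain ⟨x, hx, hxe⟩ := hB.exists_lintegral_exp_sum_geometric hβ hr hb N
    (p := 0) Set.left_mem_uIcc
  refine ⟨x, by simpa using hx, ?_⟩
  rw [← hxe]
  simp only [Real.coe_toNNReal _ (Real.exp_pos _).le, Real.exp_nat_mul,
    Real.toNNReal_pow (Real.exp_pos _).le, zero_div, zero_mul, sub_zero]

end ProbabilityTheory.IsPreBrownianReal

namespace ProbabilityTheory.IsBrownianReal

variable {Ω : Type*} [MeasurableSpace Ω] {P : Measure Ω} {B : ℝ≥0 → Ω → ℝ}

theorem ae_tendsto_sum_grid (hB : IsBrownianReal B P) {n : ℝ} (hn : 1 ≤ n) :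
    ∀ᵐ ω ∂P, Tendsto (fun N : ℕ ↦ Real.log n / N * ∑ k ∈ Finset.range N,
      B (Real.exp (k * (Real.log n / N))).toNNReal ω ^ 2 / Real.exp (k * (Real.log n / N))) atTop
      (𝓝 (Lhat B n ω)) := by
  filter_upwards [hB.cont] with ω hω
  have hg : Continuous fun s : ℝ ↦ B s.toNNReal ω := hω.comp continuous_real_toNNReal
  rw [Lhat, integral_sq_div_sq_eq_integral_exp hg (by linarith)]
  refine Continuous.tendsto_riemann_sum (h := fun u ↦ B (Real.exp u).toNNReal ω ^ 2 / Real.exp u)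
    ?_ (Real.log_nonneg hn)
  exact ((hg.comp Real.continuous_exp).pow 2).div Real.continuous_exp fun u ↦ (Real.exp_pos u).ne'

theorem lintegral_exp_Lhat_mem_Icc [IsProbabilityMeasure P] (hB : IsBrownianReal B P) {β : ℝ}
    (hβ : -(1 / 2) < β) {n : ℝ} (hn : 1 < n) :
    AEMeasurable (Lhat B n) P ∧
    ∫⁻ ω, ENNReal.ofReal (Real.exp (-(β * (1 + β) / 2) * Lhat B n ω)) ∂P ∈ Set.Icc
      (ENNReal.ofReal (Real.exp
        (-(β / 2) * Real.log n - (|β| / (1 + 2 * min 0 β) + |β| + 1))))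
      (ENNReal.ofReal (Real.exp
        (-(β / 2) * Real.log n + (|β| / (1 + 2 * min 0 β) + |β| + 1)))) := by
  set T := Real.log n with hTdef
  have hT : 0 < T := Real.log_pos hn
  set b : ℕ → ℝ := fun N ↦ 1 - Real.exp (-(T / N)) with hb
  have hb0 : Tendsto b atTop (𝓝 0) := tendsto_one_sub_exp_neg_div T
  have hbT : Tendsto (fun N : ℕ ↦ N * b N) atTop (𝓝 T) := tendsto_mul_one_sub_exp_neg_div hT.le
  -- The coefficient for which `β` is an exact fixed point at mesh `N`; it agrees with `β * (1 + β)
  -- / 2 * (T / N)` only asymptotically.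
  let γ (β : ℝ) (N : ℕ) : ℝ := β * (1 + β) * b N / (1 + β * b N) / 2
  have hγ (β : ℝ) : Tendsto (fun N : ℕ ↦ N * γ β N / T) atTop (𝓝 (β * (1 + β) / 2)) := by
    have h1 : Tendsto (fun N ↦ 1 + β * b N) atTop (𝓝 1) := by
      simpa using (hb0.const_mul β).const_add 1
    have h2 := (((hbT.const_mul (β * (1 + β) / 2)).div h1 one_ne_zero).div_const T)
    rw [div_one, mul_div_cancel_right₀ _ hT.ne'] at h2
    refine h2.congr fun N ↦ ?_
    simp only [γ, Pi.div_apply]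
    ring
  set S : ℕ → Ω → ℝ := fun N ω ↦ ∑ k ∈ Finset.range N,
    B (Real.exp (k * (T / N))).toNNReal ω ^ 2 / Real.exp (k * (T / N)) with hS
  have hSm (N : ℕ) : AEMeasurable (S N) P := by
    refine Finset.aemeasurable_fun_sum _ fun k _ ↦ ?_
    exact ((hB.aemeasurable _).pow_const 2).div_const _
  have hS0 (N : ℕ) (ω : Ω) : 0 ≤ S N ω := Finset.sum_nonneg fun k _ ↦ by positivity
  have hSL : ∀ᵐ ω ∂P, Tendsto (fun N : ℕ ↦ T / N * S N ω) atTop (𝓝 (Lhat B n ω)) :=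
    hB.ae_tendsto_sum_grid hn.le
  refine ⟨aemeasurable_of_tendsto_metrizable_ae atTop
    (fun N ↦ (hSm N).const_mul (T / N)) hSL, ?_⟩
  have hlog (β : ℝ) : Tendsto (fun N : ℕ ↦ N / 2 * Real.log (1 + β * b N)) atTop
      (𝓝 (β / 2 * T)) := by
    have := (tendsto_mul_log_one_add hb0 hbT β).div_const 2
    rw [mul_div_right_comm] at this
    exact this.congr fun N ↦ by ring
  have hbound {β : ℝ} (hβ : -(1 / 2) < β) : ∀ᶠ N in atTop,
      ∫⁻ ω, ENNReal.ofReal (Real.exp (-γ β N * S N ω)) ∂P ∈ Set.Icc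
        (ENNReal.ofReal (Real.exp (-(β / 2) * T - (|β| / (1 + 2 * min 0 β) + |β| + 1))))
        (ENNReal.ofReal (Real.exp (-(β / 2) * T + (|β| / (1 + 2 * min 0 β) + |β| + 1)))) := by
    filter_upwards [(hlog β).eventually (Metric.ball_mem_nhds _ one_pos), eventually_gt_atTop 0]
      with N hN hN0
    obtain ⟨x, hx, hxe⟩ := hB.exists_lintegral_exp_grid hβ hT hN0
    change |N / 2 * Real.log (1 + β * b N) - β / 2 * T| < 1 at hN
    change |x + N / 2 * Real.log (1 + β * b N)| ≤ _ at hx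
    change ∫⁻ ω, ENNReal.ofReal (Real.exp (-γ β N * S N ω)) ∂P = _ at hxe
    rw [hxe]
    rw [abs_lt] at hN
    rw [abs_le] at hx
    exact ⟨ENNReal.ofReal_le_ofReal (Real.exp_le_exp.2 (by linarith [hN.1, hN.2, hx.1, hx.2])),
      ENNReal.ofReal_le_ofReal (Real.exp_le_exp.2 (by linarith [hN.1, hN.2, hx.1, hx.2]))⟩
  -- Room for the higher moment: `β'` is halfway between `-1/2` and `β`. With `d = β + 1/2` and `ε =
  -- d ^ 2`, the gap is `d ^ 4 / 2 + d ^ 2 / 4`.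
  obtain ⟨ε, hε, β', hβ', hββ'⟩ : ∃ ε > 0, ∃ β' : ℝ, -(1 / 2) < β' ∧
      β' * (1 + β') / 2 < (1 + ε) * (β * (1 + β) / 2) := by
    have hd : 0 < β + 1 / 2 := by linarith
    refine ⟨(β + 1 / 2) ^ 2, by positivity, -(1 / 2) + (β + 1 / 2) / 2, by linarith, ?_⟩
    have : 0 < (β + 1 / 2) ^ 4 / 2 + (β + 1 / 2) ^ 2 / 4 := by positivity
    nlinarith
  have hlim : Tendsto (fun N ↦ ∫⁻ ω, ENNReal.ofReal (Real.exp (-γ β N * S N ω)) ∂P) atTop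
      (𝓝 (∫⁻ ω, ENNReal.ofReal (Real.exp (-(β * (1 + β) / 2) * Lhat B n ω)) ∂P)) := by
    refine tendsto_lintegral_exp_of_moment_bound (fun N ↦ (hSm N).const_mul _) ?_ hε
      (K := Real.exp (-(β' / 2) * T + (|β'| / (1 + 2 * min 0 β') + |β'| + 1))) ?_
    · filter_upwards [hSL] with ω hω
      refine ((hγ β).neg.mul hω).congr' ?_
      filter_upwards [eventually_gt_atTop 0] with N hN
      have hN0 : (N : ℝ) ≠ 0 := by exact_mod_cast hN.ne'
      field_simp
    · filter_upwards [hbound hβ', (hγ β').eventually_lt ((hγ β).const_mul (1 + ε)) hββ',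
        eventually_gt_atTop 0] with N hN hγN hN0
      refine (lintegral_mono fun ω ↦ ENNReal.ofReal_le_ofReal (Real.exp_le_exp.2 ?_)).trans hN.2
      have hN1 : (0 : ℝ) < N := by exact_mod_cast hN0
      have h1 : γ β' N ≤ (1 + ε) * γ β N := by
        have h2 : N * γ β' N / T < N * ((1 + ε) * γ β N) / T := by
          calc N * γ β' N / T < (1 + ε) * (N * γ β N / T) := hγN
            _ = _ := by ring
        rw [div_lt_div_iff_of_pos_right hT] at h2
        exact (lt_of_mul_lt_mul_left h2 hN1.le).le
      -- Since `S N ω ≥ 0`, comparing the coefficients suffices.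
      nlinarith [mul_le_mul_of_nonneg_right h1 (hS0 N ω)]
  exact isClosed_Icc.mem_of_tendsto hlim (hbound hβ)

end ProbabilityTheory.IsBrownianReal

/-! ### The logarithmic asymptotics. -/

theorem theorem8p1 (t : ℝ) (ht : -(1 / 8 : ℝ) < t) :
    ∃ C : ℝ, ∀ (Ω : Type*) [MeasurableSpace Ω] (P : Measure Ω) [IsProbabilityMeasure P]
      (B : ℝ≥0 → Ω → ℝ), IsBrownianReal B P →
      ∀ n : ℝ, 2 ≤ n →
        Integrable (fun ω ↦ Real.exp (-t * Lhat B n ω)) P ∧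
        |Real.log (∫ ω, Real.exp (-t * Lhat B n ω) ∂P)
            - (1 - Real.sqrt (1 + 8 * t)) / 4 * Real.log n| ≤ C := by
  -- The larger root of `β * (1 + β) = 2 * t`, which exceeds `-1/2` because `t > -1/8`.
  set β : ℝ := (Real.sqrt (1 + 8 * t) - 1) / 2 with hβdef
  have hpos : 0 < Real.sqrt (1 + 8 * t) := Real.sqrt_pos.2 (by linarith)
  have hβ : -(1 / 2) < β := by rw [hβdef]; linarith
  have hβt : β * (1 + β) / 2 = t := by
    have := Real.sq_sqrt (show 0 ≤ 1 + 8 * t by linarith)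
    rw [hβdef]
    linear_combination this / 8
  refine ⟨|β| / (1 + 2 * min 0 β) + |β| + 1, fun Ω _ P _ B hB n hn ↦ ?_⟩
  obtain ⟨hm, hlo, hhi⟩ := hB.lintegral_exp_Lhat_mem_Icc hβ (show 1 < n by linarith)
  rw [hβt] at hlo hhi
  generalize |β| / (1 + 2 * min 0 β) + |β| + 1 = C at *
  have hE : AEMeasurable (fun ω ↦ Real.exp (-t * Lhat B n ω)) P := by fun_prop
  have hint : Integrable (fun ω ↦ Real.exp (-t * Lhat B n ω)) P := by
    refine ⟨hE.aestronglyMeasurable, ?_⟩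
    rw [hasFiniteIntegral_iff_ofReal (ae_of_all _ fun ω ↦ (Real.exp_pos _).le)]
    exact hhi.trans_lt ENNReal.ofReal_lt_top
  refine ⟨hint, ?_⟩
  have h0 : ∀ᵐ ω ∂P, 0 ≤ Real.exp (-t * Lhat B n ω) := ae_of_all _ fun ω ↦ (Real.exp_pos _).le
  have hI0 : 0 ≤ ∫ ω, Real.exp (-t * Lhat B n ω) ∂P := integral_nonneg_of_ae h0
  rw [← ofReal_integral_eq_lintegral_ofReal hint h0] at hlo hhi
  rw [ENNReal.ofReal_le_ofReal_iff hI0] at hlo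
  rw [ENNReal.ofReal_le_ofReal_iff (Real.exp_pos _).le] at hhi
  have hI : 0 < ∫ ω, Real.exp (-t * Lhat B n ω) ∂P := (Real.exp_pos _).trans_le hlo
  have h1 := (Real.le_log_iff_exp_le hI).2 hlo
  have h2 := (Real.log_le_iff_le_exp hI).2 hhi
  have h3 : (1 - Real.sqrt (1 + 8 * t)) / 4 = -(β / 2) := by rw [hβdef]; ring
  rw [h3, abs_le]
  constructor <;> linarith
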